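/- Let $\mathcal{X}$ and $\mathcal{Y}$ be metric spaces with Borel $\sigma$-fields $\mathcal{F}$ and $\mathcal{G}$, let $\mu$ and $\nu$ be probability measures on $\mathcal{F}$ and $\mathcal{G}$, and let $\Gamma(\mu,\nu)$ be the set of probability measures $P$ on the product $\sigma$-field $\mathcal{F}\otimes\mathcal{G}$ with marginals $\mu$ and $\nu$. For a probability measure $Q$, let $L_1(Q)$ be the class of measurable, $Q$-integrable real-valued functions (not identified when equal $Q$-a.s.). Call a Borel probability measure $Q$ on a metric space separable if $Q(A)=1$ for some separable Borel set $A$. Let $c:\mathcal{X}\times\mathcal{Y}\to\mathbb{R}$ satisfy $$f_1(x)+g_1(y)\le c(x,y)\le f_2(x)+g_2(y)\quad\text{for all }(x,y)\in\mathcal{X}\times\mathcal{Y}$$ for some $f_1,f_2\in L_1(\mu)$ and $g_1,g_2\in L_1(\nu)$. Suppose that $x\mapsto c(x,y)$ is continuous for every $y\in\mathcal{Y}$ and that $y\mapsto c(x,y)$ is $\mathcal{G}$-measurable for every $x\in\mathcal{X}$. Define $$\alpha(c)=\inf_{P\in\Gamma(\mu,\nu)}\int c\,dP,\qquad \alpha^*(c)=\sup_{P\in\Gamma(\mu,\nu)}\int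 c\,dP,$$ $$\beta(c)=\sup\Bigl\{\int f\,d\mu+\int g\,d\nu:\ f\in L_1(\mu),\ g\in L_1(\nu),\ f(x)+g(y)\le c(x,y)\ \text{for all }(x,y)\Bigr\},$$ $$\beta^*(c)=\inf\Bigl\{\int f\,d\mu+\int g\,d\nu:\ f\in L_1(\mu),\ g\in L_1(\nu),\ f(x)+g(y)\ge c(x,y)\ \text{for all }(x,y)\Bigr\},$$ where $\int c\,dP$ is understood with respect to the completion of $P$. Then: (i) $\alpha^*(c)=\beta^*(c)$ if $c$ is bounded below and $\mu$ is separable; (ii) $\alpha(c)=\beta(c)$ if $c$ is bounded above and $\mu$ is separable; (iii) $\alpha(c)=\beta(c)$ and $\alpha^*(c)=\beta^*(c)$ if $c$ is bounded and $\mu$ is separable; (iv) $\alpha(c)=\beta(c)$ and $\alpha^*(c)=\beta^*(c)$ if all the sections $x\mapsto c(x,y)$ and $y\mapsto c(x,y)$ of $c$ are continuous and at least one of $\mu$ and $\nu$ is separable. Moreover, the integrals are well defined in all these cases: if $\mu$ is separable, or if all the sections of $c$ are continuous and $\nu$ is separable, then $c$ is integrable with respect to the completion of every $P\in\Gamma(\mu,\nu)$.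 -/

import Mathlib

open MeasureTheory

namespace MassTransport

variable {X Y : Type*} [MeasurableSpace X] [MeasurableSpace Y]

/-- `L₁(Q)`: the measurable, `Q`-integrable real functions (functions, not classes of functions
modulo null sets). -/
def L1 (Q : Measure X) : Set (X → ℝ) :=
  {f | Measurable f ∧ Integrable f Q}

/-- `Γ(μ, ν)`: the probability measures on the product σ-field with marginals `μ` and `ν`. -/
def couplings (μ : Measure X) (ν : Measure Y) : Set (Measure (X × Y)) :=
  {P | IsProbabilityMeasure P ∧
    (∀ A : Set X, MeasurableSet A → P (A ×ˢ Set.univ) = μ A) ∧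
    (∀ B : Set Y, MeasurableSet B → P (Set.univ ×ˢ B) = ν B)}

/-- The integrable bounds `f₁ + g₁ ≤ c ≤ f₂ + g₂` with `f₁, f₂ ∈ L₁(μ)` and `g₁, g₂ ∈ L₁(ν)`. -/
def IntegrableBounds (μ : Measure X) (ν : Measure Y) (c : X × Y → ℝ) : Prop :=
  ∃ f₁ ∈ L1 μ, ∃ g₁ ∈ L1 ν, ∃ f₂ ∈ L1 μ, ∃ g₂ ∈ L1 ν,
    ∀ x y, f₁ x + g₁ y ≤ c (x, y) ∧ c (x, y) ≤ f₂ x + g₂ y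

/-- `α(c) = inf {∫ c dP : P ∈ Γ(μ, ν)}`. The Bochner integral `∫ c ∂P` only needs `c` to be
measurable up to a `P`-null set, that is, measurable for the completion of `P`, and it is then the
integral of `c` with respect to the completion of `P`. -/
noncomputable def alpha (μ : Measure X) (ν : Measure Y) (c : X × Y → ℝ) : ℝ :=
  sInf {r | ∃ P ∈ couplings μ ν, r = ∫ p, c p ∂P}

/-- `α*(c) = sup {∫ c dP : P ∈ Γ(μ, ν)}`. -/
noncomputable def alphaStar (μ : Measure X) (ν : Measure Y) (c : X × Y → ℝ) : ℝ :=
  sSup {r | ∃ P ∈ couplings μ ν, r = ∫ p, c p ∂P}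

/-- `β(c) = sup {μ(f) + ν(g) : f ∈ L₁(μ), g ∈ L₁(ν), f + g ≤ c}`, the inequality being required
at every point. -/
noncomputable def beta (μ : Measure X) (ν : Measure Y) (c : X × Y → ℝ) : ℝ :=
  sSup {r | ∃ f ∈ L1 μ, ∃ g ∈ L1 ν, (∀ x y, f x + g y ≤ c (x, y)) ∧
    r = ∫ x, f x ∂μ + ∫ y, g y ∂ν}

/-- `β*(c) = inf {μ(f) + ν(g) : f ∈ L₁(μ), g ∈ L₁(ν), f + g ≥ c}`, the inequality being required
at every point. -/
noncomputable def betaStar (μ : Measure X) (ν : Measure Y) (c : X × Y → ℝ) : ℝ :=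
  sInf {r | ∃ f ∈ L1 μ, ∃ g ∈ L1 ν, (∀ x y, c (x, y) ≤ f x + g y) ∧
    r = ∫ x, f x ∂μ + ∫ y, g y ∂ν}

/-- A Borel probability measure on a metric space is separable if some separable Borel set has
measure one. -/
def SeparableMeasure [TopologicalSpace X] (Q : Measure X) : Prop :=
  ∃ A : Set X, MeasurableSet A ∧ TopologicalSpace.IsSeparable A ∧ Q A = 1

end MassTransport

namespace MassTransport

/-! ### Repairing the marginals of a finite measure -/

section Marginals

variable {X Y : Type*} [MeasurableSpace X] [MeasurableSpace Y]

/-! Replacing `c` by `-c` and exchanging the factors reduce every equality to `alpha = beta` with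
`μ` separable. Weak duality is integration of `f + g ≤ c` against a coupling. The converse has three
layers.

Bounded measurable cost (`exists_dual_ae`): separate `(1, 1, a - ε)` from the closed convex cone
generated by the triples (first marginal density, second marginal density, cost) in `L² × L² × ℝ`.
The point lies outside the closure because a measure whose marginal densities are `L¹`-close to one
can be turned into a coupling at small cost (`exists_coupling_integral_le`). Riesz representation
turns the separating functional into `f` and `g`, and testing it on restrictions of `μ ⊗ ν` gives
the constraint almost everywhere.

From almost everywhere to everywhere (`exists_dual_of_bounded`): continuity in `x` and separability
of a set carrying `μ` give a single null set of `y` valid for almost all `x` at once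
(`ae_forall_add_le_of_forall_ae`). On the remaining null sets `f` and `g` are replaced by a very
negative constant, which is harmless since `c` is bounded.

Integrable bounds (`exists_dual`): truncate `c`. The error is dominated by `h(x) + j(y)` with small
integrals, and this sum can be absorbed into the dual pair. -/

theorem mem_couplings_iff {μ : Measure X} {ν : Measure Y} [IsProbabilityMeasure μ]
    {P : Measure (X × Y)} : P ∈ couplings μ ν ↔ P.fst = μ ∧ P.snd = ν := by
  constructor
  · rintro ⟨_, h1, h2⟩
    constructor
    · ext A hA
      rw [Measure.fst_apply hA, ← h1 A hA, Set.prod_univ]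
    · ext B hB
      rw [Measure.snd_apply hB, ← h2 B hB, Set.univ_prod]
  · rintro ⟨h1, h2⟩
    refine ⟨⟨?_⟩, fun A hA => ?_, fun B hB => ?_⟩
    · rw [← Measure.fst_univ, h1, measure_univ]
    · rw [Set.prod_univ, ← Measure.fst_apply hA, h1]
    · rw [Set.univ_prod, ← Measure.snd_apply hB, h2]

/-- A measure with marginals `U μ` and `W ν` dominates one with marginals at most `μ` and `ν`,
up to a remainder of mass controlled by the excess of `U` and `W` over one. -/
theorem exists_trim_marginals {μ : Measure X} {ν : Measure Y} {Q : Measure (X × Y)}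
    {U : X → ENNReal} {W : Y → ENNReal} (hU : Measurable U) (hW : Measurable W)
    (hU' : ∀ x, U x ≠ ⊤) (hW' : ∀ y, W y ≠ ⊤)
    (h1 : Q.fst = μ.withDensity U) (h2 : Q.snd = ν.withDensity W) :
    ∃ Q' R : Measure (X × Y), Q = Q' + R ∧ Q'.fst ≤ μ ∧ Q'.snd ≤ ν ∧
      R Set.univ ≤ ∫⁻ x, (U x - 1) ∂μ + ∫⁻ y, (W y - 1) ∂ν := by
  have key : ∀ t : ENNReal, t ≠ ⊤ → t * (1 - min 1 t⁻¹) ≤ t - 1 := by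
    intro t ht
    rcases le_total t 1 with h | h
    · rw [min_eq_left (ENNReal.one_le_inv.2 h)]
      simp
    · have h0 : t ≠ 0 := (zero_lt_one.trans_le h).ne'
      rw [min_eq_right (ENNReal.inv_le_one.2 h), ENNReal.mul_sub (fun _ _ => ht), mul_one,
        ENNReal.mul_inv_cancel h0 ht]
  have key2 : ∀ t : ENNReal, t * min 1 t⁻¹ ≤ 1 := fun t =>
    (mul_le_mul_right (min_le_right _ _) t).trans (ENNReal.mul_inv_le_one t)
  -- Weighting `Q` by `a(x) b(y)` trims both marginals at once: `U a ≤ 1` and `W b ≤ 1`, and each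
  -- factor is at most one, so neither spoils the bound due to the other.
  set a : X → ENNReal := fun x => min 1 (U x)⁻¹ with ha
  set b : Y → ENNReal := fun y => min 1 (W y)⁻¹ with hb
  have ham : Measurable a := measurable_const.min hU.inv
  have hbm : Measurable b := measurable_const.min hW.inv
  have ha1 : ∀ x, a x ≤ 1 := fun x => min_le_left _ _
  have hb1 : ∀ y, b y ≤ 1 := fun y => min_le_left _ _
  set ab : X × Y → ENNReal := fun p => a p.1 * b p.2 with hab
  have habm : Measurable ab := (ham.comp measurable_fst).mul (hbm.comp measurable_snd)
  have hab1 : ∀ p, ab p ≤ 1 := fun p => mul_le_one' (ha1 _) (hb1 _)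
  refine ⟨Q.withDensity ab, Q.withDensity (fun p => 1 - ab p), ?_, ?_, ?_, ?_⟩
  · rw [← withDensity_add_left habm]
    have : (ab + fun p => 1 - ab p) = 1 := by
      funext p
      exact add_tsub_cancel_of_le (hab1 p)
    rw [this, withDensity_one]
  · refine Measure.le_iff.2 fun A hA => ?_
    rw [Measure.fst_apply hA, withDensity_apply _ (measurable_fst hA)]
    calc ∫⁻ p in Prod.fst ⁻¹' A, ab p ∂Q
        ≤ ∫⁻ p in Prod.fst ⁻¹' A, a p.1 ∂Q :=
          lintegral_mono fun p => mul_le_of_le_one_right' (hb1 _)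
      _ = ∫⁻ x in A, a x ∂Q.fst := by
          rw [Measure.fst, setLIntegral_map hA ham measurable_fst]
      _ = ∫⁻ x in A, (U * a) x ∂μ := by
          rw [h1, setLIntegral_withDensity_eq_setLIntegral_mul _ hU ham hA]
      _ ≤ ∫⁻ x in A, 1 ∂μ := lintegral_mono fun x => key2 _
      _ = μ A := by simp
  · refine Measure.le_iff.2 fun B hB => ?_
    rw [Measure.snd_apply hB, withDensity_apply _ (measurable_snd hB)]
    calc ∫⁻ p in Prod.snd ⁻¹' B, ab p ∂Q
        ≤ ∫⁻ p in Prod.snd ⁻¹' B, b p.2 ∂Q :=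
          lintegral_mono fun p => mul_le_of_le_one_left' (ha1 _)
      _ = ∫⁻ y in B, b y ∂Q.snd := by
          rw [Measure.snd, setLIntegral_map hB hbm measurable_snd]
      _ = ∫⁻ y in B, (W * b) y ∂ν := by
          rw [h2, setLIntegral_withDensity_eq_setLIntegral_mul _ hW hbm hB]
      _ ≤ ∫⁻ y in B, 1 ∂ν := lintegral_mono fun y => key2 _
      _ = ν B := by simp
  · rw [withDensity_apply _ MeasurableSet.univ, setLIntegral_univ]
    -- This splits the lost mass into functions of one variable, so that only the marginals of `Q`
    -- enter.
    have hsplit : ∀ p : X × Y, 1 - ab p ≤ (1 - a p.1) + (1 - b p.2) := by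
      intro p
      rw [tsub_le_iff_right]
      calc (1 : ENNReal) = (1 - a p.1) + a p.1 * 1 := by
            rw [mul_one, tsub_add_cancel_of_le (ha1 _)]
        _ = (1 - a p.1) + a p.1 * ((1 - b p.2) + b p.2) := by
            rw [tsub_add_cancel_of_le (hb1 _)]
        _ = (1 - a p.1) + a p.1 * (1 - b p.2) + ab p := by rw [mul_add, ← add_assoc]
        _ ≤ (1 - a p.1) + (1 - b p.2) + ab p := by
            gcongr
            exact mul_le_of_le_one_left' (ha1 _)
    have ham' : Measurable fun x => 1 - a x := measurable_const.sub ham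
    have hbm' : Measurable fun y => 1 - b y := measurable_const.sub hbm
    calc ∫⁻ p, (1 - ab p) ∂Q
        ≤ ∫⁻ p, ((1 - a p.1) + (1 - b p.2)) ∂Q := lintegral_mono hsplit
      _ = ∫⁻ p, (1 - a p.1) ∂Q + ∫⁻ p, (1 - b p.2) ∂Q :=
          lintegral_add_left (ham'.comp measurable_fst) _
      _ = ∫⁻ x, (1 - a x) ∂Q.fst + ∫⁻ y, (1 - b y) ∂Q.snd := by
          rw [Measure.fst, Measure.snd, lintegral_map ham' measurable_fst,
            lintegral_map hbm' measurable_snd]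
      _ = ∫⁻ x, (U * fun x => 1 - a x) x ∂μ + ∫⁻ y, (W * fun y => 1 - b y) y ∂ν := by
          rw [h1, h2, lintegral_withDensity_eq_lintegral_mul _ hU ham',
            lintegral_withDensity_eq_lintegral_mul _ hW hbm']
      _ ≤ _ := add_le_add (lintegral_mono fun x => key _ (hU' x))
          (lintegral_mono fun y => key _ (hW' y))

/-- A measure with marginals at most `μ` and `ν` is dominated by a coupling. -/
theorem exists_add_mem_couplings {μ : Measure X} {ν : Measure Y} [IsProbabilityMeasure μ]
    [IsProbabilityMeasure ν] {Q : Measure (X × Y)} (h1 : Q.fst ≤ μ) (h2 : Q.snd ≤ ν) :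
    ∃ S : Measure (X × Y), Q + S ∈ couplings μ ν := by
  have hQ : Q Set.univ ≤ 1 := by
    rw [← Measure.fst_univ, ← measure_univ (μ := μ)]
    exact h1 _
  have : IsFiniteMeasure Q := ⟨hQ.trans_lt ENNReal.one_lt_top⟩
  set m : ENNReal := 1 - Q Set.univ with hm
  have hmt : m ≠ ⊤ := ENNReal.sub_ne_top ENNReal.one_ne_top
  have hμ : (μ - Q.fst) Set.univ = m := by
    rw [Measure.sub_apply MeasurableSet.univ h1, measure_univ, Measure.fst_univ]
  have hν : (ν - Q.snd) Set.univ = m := by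
    rw [Measure.sub_apply MeasurableSet.univ h2, measure_univ, Measure.snd_univ]
  -- The two marginal deficits have the same mass `m`, so their normalized product fills both. If `m
  -- = 0`, the factor is `⊤` but multiplies the zero measure.
  refine ⟨m⁻¹ • (μ - Q.fst).prod (ν - Q.snd), mem_couplings_iff.2 ⟨?_, ?_⟩⟩
  · rw [Measure.fst_add, Measure.fst, Measure.fst, Measure.map_smul, Measure.map_fst_prod, hν,
      smul_smul]
    rcases eq_or_ne m 0 with h0 | h0
    · rw [h0] at hμ
      have := Measure.measure_univ_eq_zero.1 hμ
      have h3 := Measure.sub_add_cancel_of_le h1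
      rw [← Measure.fst, this, smul_zero, add_zero]
      rwa [this, zero_add] at h3
    · rw [ENNReal.inv_mul_cancel h0 hmt, one_smul, ← Measure.fst, add_comm]
      exact Measure.sub_add_cancel_of_le h1
  · rw [Measure.snd_add, Measure.snd, Measure.snd, Measure.map_smul, Measure.map_snd_prod, hμ,
      smul_smul]
    rcases eq_or_ne m 0 with h0 | h0
    · rw [h0] at hν
      have := Measure.measure_univ_eq_zero.1 hν
      have h3 := Measure.sub_add_cancel_of_le h2
      rw [← Measure.snd, this, smul_zero, add_zero]
      rwa [this, zero_add] at h3
    · rw [ENNReal.inv_mul_cancel h0 hmt, one_smul, ← Measure.snd, add_comm]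
      exact Measure.sub_add_cancel_of_le h2

theorem norm_integral_le_mul_mass {c : X → ℝ} {M : ℝ} (hM : ∀ p, |c p| ≤ M) (Q : Measure X)
    [IsFiniteMeasure Q] : |∫ p, c p ∂Q| ≤ M * Q.real Set.univ := by
  simpa using norm_integral_le_of_norm_le_const (μ := Q) (f := c) (C := M)
    (Filter.Eventually.of_forall hM)

theorem lintegral_ofReal_sub_one_le {μ : Measure X} [IsFiniteMeasure μ] {u : X → ℝ}
    (hu : Integrable u μ) :
    ∫⁻ x, (ENNReal.ofReal (u x) - 1) ∂μ ≤ ENNReal.ofReal (∫ x, |u x - 1| ∂μ) := by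
  have hi : Integrable (fun x => |u x - 1|) μ := (hu.sub (integrable_const 1)).abs
  rw [ofReal_integral_eq_lintegral_ofReal hi (Filter.Eventually.of_forall fun x => abs_nonneg _)]
  refine lintegral_mono fun x => ?_
  rw [← ENNReal.ofReal_one, ← ENNReal.ofReal_sub _ zero_le_one]
  exact ENNReal.ofReal_le_ofReal (le_abs_self _)

/-- A measure whose marginals have densities close to one can be replaced by a coupling, at a cost
controlled by the `L¹` distance of the densities to one. -/
theorem exists_coupling_integral_le {μ : Measure X} {ν : Measure Y} [IsProbabilityMeasure μ]
    [IsProbabilityMeasure ν] {Q : Measure (X × Y)} [IsFiniteMeasure Q] {u : X → ℝ} {w : Y → ℝ}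
    (hu : Measurable u) (hw : Measurable w) (hui : Integrable u μ) (hwi : Integrable w ν)
    (hu0 : 0 ≤ᵐ[μ] u)
    (h1 : Q.fst = μ.withDensity fun x => ENNReal.ofReal (u x))
    (h2 : Q.snd = ν.withDensity fun y => ENNReal.ofReal (w y))
    {c : X × Y → ℝ} (hc : Measurable c) {M : ℝ} (hM : ∀ p, |c p| ≤ M) :
    ∃ P ∈ couplings μ ν,
      ∫ p, c p ∂P ≤ ∫ p, c p ∂Q + 3 * M * (∫ x, |u x - 1| ∂μ + ∫ y, |w y - 1| ∂ν) := by
  obtain ⟨Q', R, hQ, hf, hs, hR⟩ := exists_trim_marginals hu.ennreal_ofReal hw.ennreal_ofReal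
    (fun _ => ENNReal.ofReal_ne_top) (fun _ => ENNReal.ofReal_ne_top) h1 h2
  obtain ⟨S, hS⟩ := exists_add_mem_couplings hf hs
  refine ⟨_, hS, ?_⟩
  set η := ∫ x, |u x - 1| ∂μ + ∫ y, |w y - 1| ∂ν with hη
  have hη1 : 0 ≤ ∫ x, |u x - 1| ∂μ := integral_nonneg fun _ => abs_nonneg _
  have hη2 : 0 ≤ ∫ y, |w y - 1| ∂ν := integral_nonneg fun _ => abs_nonneg _
  have hRη : R Set.univ ≤ ENNReal.ofReal η := by
    rw [hη, ENNReal.ofReal_add hη1 hη2]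
    exact hR.trans (add_le_add (lintegral_ofReal_sub_one_le hui) (lintegral_ofReal_sub_one_le hwi))
  have : IsProbabilityMeasure (Q' + S) := hS.1
  have fQ' : IsFiniteMeasure Q' :=
    isFiniteMeasure_of_le (Q' + S) (Measure.le_add_right le_rfl)
  have fS : IsFiniteMeasure S := isFiniteMeasure_of_le (Q' + S) (Measure.le_add_left le_rfl)
  have fR : IsFiniteMeasure R := ⟨hRη.trans_lt ENNReal.ofReal_lt_top⟩
  have hRr : R.real Set.univ ≤ η := ENNReal.toReal_le_of_le_ofReal (add_nonneg hη1 hη2) hRη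
  have hmQ : Q.real Set.univ = ∫ x, u x ∂μ := by
    rw [Measure.real, ← Measure.fst_univ, h1, withDensity_apply _ MeasurableSet.univ,
      setLIntegral_univ, ← ofReal_integral_eq_lintegral_ofReal hui hu0,
      ENNReal.toReal_ofReal (integral_nonneg_of_ae hu0)]
  have hone : 1 - Q.real Set.univ ≤ η := by
    have : ∫ x, (1 - u x) ∂μ ≤ ∫ x, |u x - 1| ∂μ := by
      refine integral_mono ((integrable_const _).sub hui) (hui.sub (integrable_const 1)).abs ?_
      intro x
      simp only
      rw [abs_sub_comm]
      exact le_abs_self _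
    rw [integral_sub (integrable_const _) hui] at this
    simp only [integral_const, probReal_univ, smul_eq_mul, mul_one] at this
    rw [hmQ]
    linarith
  have hsumQ : Q.real Set.univ = Q'.real Set.univ + R.real Set.univ := by
    rw [hQ, measureReal_add_apply]
  have hsumS : 1 = Q'.real Set.univ + S.real Set.univ := by
    rw [← measureReal_add_apply, probReal_univ]
  have hint : ∀ (T : Measure (X × Y)) [IsFiniteMeasure T], Integrable c T := fun T _ =>
    Integrable.of_bound hc.aestronglyMeasurable M (Filter.Eventually.of_forall hM)
  have hM0 : 0 ≤ M := by
    obtain ⟨p⟩ := nonempty_of_isProbabilityMeasure (Q' + S)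
    exact (abs_nonneg _).trans (hM p)
  have e1 := norm_integral_le_mul_mass hM S
  have e2 := norm_integral_le_mul_mass hM R
  rw [hQ, integral_add_measure (hint Q') (hint S), integral_add_measure (hint Q') (hint R)]
  -- The constant 3: the removed part `R` has mass at most `η`, and the added part `S` has mass `1 -
  -- Q(univ) + R(univ) ≤ 2η`.
  have e3 : M * S.real Set.univ ≤ M * (2 * η) := by gcongr; linarith
  have e4 : M * R.real Set.univ ≤ M * η := by gcongr
  have := (abs_le.1 e1).2
  have := (abs_le.1 e2).1
  linarith

end Marginals

end MassTransport

namespace MassTransport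

/-! ### Hahn–Banach duality in `L²` for bounded measurable costs -/

section Cone

variable {X Y : Type*} [MeasurableSpace X] [MeasurableSpace Y]

theorem integral_abs_le_norm {μ : Measure X} [IsProbabilityMeasure μ] (h : Lp ℝ 2 μ) :
    ∫ x, |h x| ∂μ ≤ ‖h‖ := by
  have h1 : ∫ x, |h x| ∂μ = (eLpNorm h 1 μ).toReal := by
    simp_rw [← Real.norm_eq_abs]
    rw [integral_norm_eq_lintegral_enorm (Lp.aestronglyMeasurable h), eLpNorm_one_eq_lintegral_enorm]
  rw [h1, Lp.norm_def]
  exact ENNReal.toReal_mono (Lp.eLpNorm_ne_top h)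
    (eLpNorm_le_eLpNorm_of_exponent_le (by norm_num) (Lp.aestronglyMeasurable h))

theorem integrable_coe_Lp_two {μ : Measure X} [IsFiniteMeasure μ] (h : Lp ℝ 2 μ) :
    Integrable h μ :=
  (Lp.memLp h).integrable (by norm_num)

/-- The Radon–Nikodym density of a dominated measure is at most one, hence square integrable. This
makes `L²` available, where functionals are represented by functions. -/
theorem exists_Lp_density_of_le {μ m : Measure X} [IsFiniteMeasure μ] (hm : m ≤ μ) :
    ∃ u : Lp ℝ 2 μ, 0 ≤ᵐ[μ] u ∧ m = μ.withDensity fun x => ENNReal.ofReal (u x) := by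
  have : IsFiniteMeasure m := isFiniteMeasure_of_le μ hm
  have h1 := Measure.rnDeriv_le_one_of_le hm
  have hL : MemLp (fun x => (m.rnDeriv μ x).toReal) 2 μ := by
    refine MemLp.of_bound (Measure.measurable_rnDeriv m μ).ennreal_toReal.aestronglyMeasurable 1 ?_
    filter_upwards [h1] with x hx
    rw [Real.norm_eq_abs, abs_of_nonneg ENNReal.toReal_nonneg]
    exact ENNReal.toReal_le_of_le_ofReal zero_le_one (by simpa using hx)
  refine ⟨hL.toLp, ?_, ?_⟩
  · filter_upwards [hL.coeFn_toLp] with x hx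
    rw [hx]
    exact ENNReal.toReal_nonneg
  · conv_lhs => rw [← Measure.withDensity_rnDeriv_eq m μ (Measure.absolutelyContinuous_of_le hm)]
    refine withDensity_congr_ae ?_
    filter_upwards [hL.coeFn_toLp, h1] with x hx hx1
    rw [hx, ENNReal.ofReal_toReal (ne_top_of_le_ne_top ENNReal.one_ne_top hx1)]

theorem integral_withDensity_ofReal_eq_inner {μ : Measure X} {u : Lp ℝ 2 μ} (hu : 0 ≤ᵐ[μ] u)
    (f : Lp ℝ 2 μ) :
    ∫ x, f x ∂(μ.withDensity fun x => ENNReal.ofReal (u x)) = inner ℝ f u := by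
  rw [integral_withDensity_eq_integral_toReal_smul
    (Lp.stronglyMeasurable u).measurable.ennreal_ofReal (by simp), L2.inner_def]
  refine integral_congr_ae ?_
  filter_upwards [hu] with x hx
  simp [ENNReal.toReal_ofReal hx]

theorem integrable_withDensity_ofReal {μ : Measure X} {u : Lp ℝ 2 μ} (hu : 0 ≤ᵐ[μ] u)
    (f : Lp ℝ 2 μ) :
    Integrable f (μ.withDensity fun x => ENNReal.ofReal (u x)) := by
  rw [integrable_withDensity_iff_integrable_smul'
    (Lp.stronglyMeasurable u).measurable.ennreal_ofReal (by simp)]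
  refine (L2.integrable_inner (𝕜 := ℝ) f u).congr ?_
  filter_upwards [hu] with x hx
  simp [ENNReal.toReal_ofReal hx]

/-- The triples `(u, w, t)` such that some finite measure with marginals `u μ` and `w ν` has cost
at most `t`. -/
def costCone (μ : Measure X) (ν : Measure Y) (c : X × Y → ℝ) : Set (Lp ℝ 2 μ × Lp ℝ 2 ν × ℝ) :=
  {z | 0 ≤ᵐ[μ] z.1 ∧ 0 ≤ᵐ[ν] z.2.1 ∧ ∃ Q : Measure (X × Y), IsFiniteMeasure Q ∧
    (Q.fst = μ.withDensity fun x => ENNReal.ofReal (z.1 x)) ∧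
    (Q.snd = ν.withDensity fun y => ENNReal.ofReal (z.2.1 y)) ∧ ∫ p, c p ∂Q ≤ z.2.2}

theorem withDensity_ofReal_coe_add {μ : Measure X} {u v : Lp ℝ 2 μ} (hu : 0 ≤ᵐ[μ] u)
    (hv : 0 ≤ᵐ[μ] v) :
    (μ.withDensity fun x => ENNReal.ofReal ((u + v) x)) =
      (μ.withDensity fun x => ENNReal.ofReal (u x)) +
        μ.withDensity fun x => ENNReal.ofReal (v x) := by
  rw [← withDensity_add_left (Lp.stronglyMeasurable u).measurable.ennreal_ofReal]
  refine withDensity_congr_ae ?_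
  filter_upwards [hu, hv, Lp.coeFn_add u v] with x h1 h2 h3
  simp only [Pi.add_apply, h3]
  exact ENNReal.ofReal_add h1 h2

theorem withDensity_ofReal_coe_smul {μ : Measure X} (u : Lp ℝ 2 μ) {r : ℝ} (hr : 0 ≤ r) :
    (μ.withDensity fun x => ENNReal.ofReal ((r • u) x)) =
      ENNReal.ofReal r • μ.withDensity fun x => ENNReal.ofReal (u x) := by
  rw [← withDensity_smul _ (Lp.stronglyMeasurable u).measurable.ennreal_ofReal]
  refine withDensity_congr_ae ?_
  filter_upwards [Lp.coeFn_smul r u] with x h3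
  simp only [Pi.smul_apply, h3, smul_eq_mul]
  exact ENNReal.ofReal_mul hr

theorem costCone_add {μ : Measure X} {ν : Measure Y} {c : X × Y → ℝ} (hc : Measurable c) {M : ℝ}
    (hM : ∀ p, |c p| ≤ M) {z z' : Lp ℝ 2 μ × Lp ℝ 2 ν × ℝ} (hz : z ∈ costCone μ ν c)
    (hz' : z' ∈ costCone μ ν c) : z + z' ∈ costCone μ ν c := by
  obtain ⟨h1, h2, Q, hQ, hf, hs, ht⟩ := hz
  obtain ⟨h1', h2', Q', hQ', hf', hs', ht'⟩ := hz'
  have hint : ∀ (T : Measure (X × Y)) [IsFiniteMeasure T], Integrable c T := fun T _ =>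
    Integrable.of_bound hc.aestronglyMeasurable M (Filter.Eventually.of_forall hM)
  refine ⟨?_, ?_, Q + Q', inferInstance, ?_, ?_, ?_⟩
  · filter_upwards [h1, h1', Lp.coeFn_add z.1 z'.1] with x a b e
    simp only [Prod.fst_add, e, Pi.add_apply]
    exact add_nonneg a b
  · filter_upwards [h2, h2', Lp.coeFn_add z.2.1 z'.2.1] with x a b e
    simp only [Prod.fst_add, Prod.snd_add, e, Pi.add_apply]
    exact add_nonneg a b
  · rw [Measure.fst_add, hf, hf', Prod.fst_add, withDensity_ofReal_coe_add h1 h1']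
  · rw [Measure.snd_add, hs, hs', Prod.snd_add, Prod.fst_add, withDensity_ofReal_coe_add h2 h2']
  · rw [integral_add_measure (hint Q) (hint Q')]
    exact add_le_add ht ht'

theorem costCone_smul {μ : Measure X} {ν : Measure Y} {c : X × Y → ℝ}
    {z : Lp ℝ 2 μ × Lp ℝ 2 ν × ℝ} (hz : z ∈ costCone μ ν c) {r : ℝ} (hr : 0 ≤ r) :
    r • z ∈ costCone μ ν c := by
  obtain ⟨h1, h2, Q, hQ, hf, hs, ht⟩ := hz
  refine ⟨?_, ?_, ENNReal.ofReal r • Q, Q.smul_finite ENNReal.ofReal_ne_top, ?_, ?_, ?_⟩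
  · filter_upwards [h1, Lp.coeFn_smul r z.1] with x a e
    simp only [Prod.smul_fst, e, Pi.smul_apply, smul_eq_mul]
    exact mul_nonneg hr a
  · filter_upwards [h2, Lp.coeFn_smul r z.2.1] with x a e
    simp only [Prod.smul_fst, Prod.smul_snd, e, Pi.smul_apply, smul_eq_mul]
    exact mul_nonneg hr a
  · rw [Measure.fst, Measure.map_smul, ← Measure.fst, hf, Prod.smul_fst,
      withDensity_ofReal_coe_smul _ hr]
  · rw [Measure.snd, Measure.map_smul, ← Measure.snd, hs, Prod.smul_snd, Prod.smul_fst,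
      withDensity_ofReal_coe_smul _ hr]
  · rw [integral_smul_measure, ENNReal.toReal_ofReal hr]
    exact mul_le_mul_of_nonneg_left ht hr

/-- Every finite measure with marginals dominated by `μ` and `ν` gives a point of the cone. -/
theorem exists_mem_costCone {μ : Measure X} {ν : Measure Y} [IsFiniteMeasure μ]
    [IsFiniteMeasure ν] (c : X × Y → ℝ) {Q : Measure (X × Y)} (h1 : Q.fst ≤ μ) (h2 : Q.snd ≤ ν) :
    ∃ z ∈ costCone μ ν c, z.2.2 = ∫ p, c p ∂Q ∧
      (∀ f : Lp ℝ 2 μ, Integrable (fun p : X × Y => f p.1) Q ∧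
        ∫ p : X × Y, f p.1 ∂Q = inner ℝ f z.1) ∧
      (∀ g : Lp ℝ 2 ν, Integrable (fun p : X × Y => g p.2) Q ∧
        ∫ p : X × Y, g p.2 ∂Q = inner ℝ g z.2.1) := by
  obtain ⟨u, hu, hu'⟩ := exists_Lp_density_of_le h1
  obtain ⟨w, hw, hw'⟩ := exists_Lp_density_of_le h2
  have : IsFiniteMeasure Q := ⟨by
    rw [← Measure.fst_univ]
    exact (h1 _).trans_lt (measure_lt_top μ _)⟩
  refine ⟨(u, w, ∫ p, c p ∂Q), ⟨hu, hw, Q, this, hu', hw', le_rfl⟩, rfl, fun f => ?_, fun g => ?_⟩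
  · have hi := integrable_withDensity_ofReal hu f
    rw [← hu'] at hi
    refine ⟨hi.comp_measurable measurable_fst, ?_⟩
    rw [← integral_withDensity_ofReal_eq_inner hu f, ← hu', Measure.fst,
      integral_map measurable_fst.aemeasurable (Lp.stronglyMeasurable f).aestronglyMeasurable]
  · have hi := integrable_withDensity_ofReal hw g
    rw [← hw'] at hi
    refine ⟨hi.comp_measurable measurable_snd, ?_⟩
    rw [← integral_withDensity_ofReal_eq_inner hw g, ← hw', Measure.snd,
      integral_map measurable_snd.aemeasurable (Lp.stronglyMeasurable g).aestronglyMeasurable]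

/-- Correcting the marginals to `μ` and `ν` changes the cost by a multiple of the `L¹` distances to
one, which the `L²` norms dominate. The resulting bound is continuous in `z`, so it survives on the
closure of the cone. -/
theorem le_of_mem_costCone {μ : Measure X} {ν : Measure Y} [IsProbabilityMeasure μ]
    [IsProbabilityMeasure ν] {c : X × Y → ℝ} (hc : Measurable c) {M : ℝ} (hM : ∀ p, |c p| ≤ M)
    {a : ℝ} (ha : ∀ P ∈ couplings μ ν, a ≤ ∫ p, c p ∂P) {z : Lp ℝ 2 μ × Lp ℝ 2 ν × ℝ}
    (hz : z ∈ costCone μ ν c) :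
    a ≤ z.2.2 + 3 * M * (‖z.1 - Lp.const 2 μ (1 : ℝ)‖ + ‖z.2.1 - Lp.const 2 ν (1 : ℝ)‖) := by
  obtain ⟨h1, h2, Q, hQ, hf, hs, ht⟩ := hz
  obtain ⟨P, hP, hPc⟩ := exists_coupling_integral_le (Lp.stronglyMeasurable z.1).measurable
    (Lp.stronglyMeasurable z.2.1).measurable (integrable_coe_Lp_two _) (integrable_coe_Lp_two _)
    h1 hf hs hc hM
  have hM0 : 0 ≤ M := by
    obtain ⟨p⟩ := nonempty_of_isProbabilityMeasure (μ.prod ν)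
    exact (abs_nonneg _).trans (hM p)
  have e1 : ∫ x, |z.1 x - 1| ∂μ ≤ ‖z.1 - Lp.const 2 μ (1 : ℝ)‖ := by
    refine le_trans (le_of_eq ?_) (integral_abs_le_norm _)
    refine integral_congr_ae ?_
    filter_upwards [Lp.coeFn_sub z.1 (Lp.const 2 μ (1 : ℝ)), Lp.coeFn_const 2 μ (1 : ℝ)]
      with x h h'
    rw [h, Pi.sub_apply, h', Function.const_apply]
  have e2 : ∫ x, |z.2.1 x - 1| ∂ν ≤ ‖z.2.1 - Lp.const 2 ν (1 : ℝ)‖ := by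
    refine le_trans (le_of_eq ?_) (integral_abs_le_norm _)
    refine integral_congr_ae ?_
    filter_upwards [Lp.coeFn_sub z.2.1 (Lp.const 2 ν (1 : ℝ)), Lp.coeFn_const 2 ν (1 : ℝ)]
      with x h h'
    rw [h, Pi.sub_apply, h', Function.const_apply]
  have e3 := mul_le_mul_of_nonneg_left (add_le_add e1 e2) (by positivity : 0 ≤ 3 * M)
  linarith [ha P hP]

/-- Duality for a bounded measurable cost, the dual constraint being required almost everywhere
with respect to `μ ⊗ ν`. -/
theorem exists_dual_ae {μ : Measure X} {ν : Measure Y} [IsProbabilityMeasure μ]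
    [IsProbabilityMeasure ν] {c : X × Y → ℝ} (hc : Measurable c) {M : ℝ} (hM : ∀ p, |c p| ≤ M)
    {a : ℝ} (ha : ∀ P ∈ couplings μ ν, a ≤ ∫ p, c p ∂P) {ε : ℝ} (hε : 0 < ε) :
    ∃ f ∈ L1 μ, ∃ g ∈ L1 ν, (∀ᵐ p ∂(μ.prod ν), f p.1 + g p.2 ≤ c p) ∧
      a - ε ≤ ∫ x, f x ∂μ + ∫ y, g y ∂ν := by
  set C := costCone μ ν c with hC
  set e₁ : Lp ℝ 2 μ := Lp.const 2 μ (1 : ℝ) with he₁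
  set e₂ : Lp ℝ 2 ν := Lp.const 2 ν (1 : ℝ) with he₂
  have hfst : (μ.prod ν).fst = μ := Measure.fst_prod
  have hsnd : (μ.prod ν).snd = ν := Measure.snd_prod
  have hconv : Convex ℝ (closure C) := by
    refine Convex.closure ?_
    intro z hz z' hz' s t hs ht _
    exact costCone_add hc hM (costCone_smul hz hs) (costCone_smul hz' ht)
  -- At this point the norm terms vanish and the closed inequality of `le_of_mem_costCone` would
  -- read `a ≤ a - ε`.
  have hnot : (e₁, e₂, a - ε) ∉ closure C := by
    intro hmem
    have hcl : IsClosed {z : Lp ℝ 2 μ × Lp ℝ 2 ν × ℝ |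
        a ≤ z.2.2 + 3 * M * (‖z.1 - e₁‖ + ‖z.2.1 - e₂‖)} :=
      isClosed_le continuous_const (by fun_prop)
    have := closure_minimal (fun z hz => le_of_mem_costCone hc hM ha hz) hcl hmem
    change a ≤ a - ε + 3 * M * (‖e₁ - e₁‖ + ‖e₂ - e₂‖) at this
    rw [sub_self, sub_self, norm_zero, norm_zero, add_zero, mul_zero] at this
    linarith
  obtain ⟨ℓ, s, hs, hsC⟩ := geometric_hahn_banach_point_closed hconv isClosed_closure hnot
  have hzero : (0 : Lp ℝ 2 μ × Lp ℝ 2 ν × ℝ) ∈ C := by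
    obtain ⟨z, hz, -⟩ := exists_mem_costCone (μ := μ) (ν := ν) c (Q := 0)
      (by rw [Measure.fst_zero]; exact Measure.zero_le _)
      (by rw [Measure.snd_zero]; exact Measure.zero_le _)
    simpa using costCone_smul hz le_rfl
  have hs0 : s < 0 := by simpa using hsC 0 (subset_closure hzero)
  -- A functional bounded below on a cone is nonnegative there: if `ℓ z < 0`, scaling `z` by `s / ℓ
  -- z` reaches the value `s`, which `ℓ` strictly exceeds on the cone.
  have hpos : ∀ z ∈ C, 0 ≤ ℓ z := by
    intro z hz
    by_contra! hneg
    have h := hsC _ (subset_closure (costCone_smul hz (div_nonneg_of_nonpos hs0.le hneg.le)))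
    rw [map_smul, smul_eq_mul, div_mul_cancel₀ _ hneg.ne] at h
    exact lt_irrefl _ h
  set f := (InnerProductSpace.toDual ℝ (Lp ℝ 2 μ)).symm
    (ℓ.comp (ContinuousLinearMap.inl ℝ (Lp ℝ 2 μ) (Lp ℝ 2 ν × ℝ))) with hf
  set g := (InnerProductSpace.toDual ℝ (Lp ℝ 2 ν)).symm
    ((ℓ.comp (ContinuousLinearMap.inr ℝ (Lp ℝ 2 μ) (Lp ℝ 2 ν × ℝ))).comp
      (ContinuousLinearMap.inl ℝ (Lp ℝ 2 ν) ℝ)) with hg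
  set r := ℓ (0, 0, 1) with hr
  have hℓ : ∀ z, ℓ z = inner ℝ f z.1 + inner ℝ g z.2.1 + r * z.2.2 := by
    intro z
    rw [hf, hg, InnerProductSpace.toDual_symm_apply, InnerProductSpace.toDual_symm_apply]
    simp only [ContinuousLinearMap.comp_apply, ContinuousLinearMap.inl_apply,
      ContinuousLinearMap.inr_apply]
    rw [hr, mul_comm, ← smul_eq_mul, ← map_smul, ← map_add, ← map_add]
    congr 1
    ext <;> simp
  -- The cone is closed under increasing the last coordinate.
  have hr0 : 0 ≤ r := by
    have : ((0, 0, 1) : Lp ℝ 2 μ × Lp ℝ 2 ν × ℝ) ∈ C := by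
      obtain ⟨h1, h2, Q, hQ, h3, h4, h5⟩ := hzero
      exact ⟨h1, h2, Q, hQ, h3, h4, h5.trans zero_le_one⟩
    exact hpos _ this
  obtain ⟨z, hz, hzc, hzf, hzg⟩ := exists_mem_costCone (μ := μ) (ν := ν) c (Q := μ.prod ν)
    hfst.le hsnd.le
  have hfe : ∫ x, f x ∂μ = inner ℝ f e₁ := by
    rw [L2.inner_def]
    refine integral_congr_ae ?_
    filter_upwards [Lp.coeFn_const 2 μ (1 : ℝ)] with x hx
    rw [he₁, hx]
    simp
  have hge : ∫ y, g y ∂ν = inner ℝ g e₂ := by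
    rw [L2.inner_def]
    refine integral_congr_ae ?_
    filter_upwards [Lp.coeFn_const 2 ν (1 : ℝ)] with x hx
    rw [he₂, hx]
    simp
  have hfz : inner ℝ f z.1 = ∫ x, f x ∂μ := by
    simpa [(hzf f).2] using integral_fun_fst (μ := μ) (ν := ν) (fun x => f x)
  have hgz : inner ℝ g z.2.1 = ∫ y, g y ∂ν := by
    simpa [(hzg g).2] using integral_fun_snd (μ := μ) (ν := ν) (fun y => g y)
  have hneg : ∫ x, f x ∂μ + ∫ y, g y ∂ν + r * (a - ε) < 0 := by
    have := hs.trans hs0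
    rwa [hℓ, ← hfe, ← hge] at this
  -- The separating hyperplane is not vertical: the product coupling gives a point of the cone over
  -- `(1, 1)`, where `r = 0` would contradict `hneg`.
  have hrpos : 0 < r := by
    have h := hpos z hz
    rw [hℓ, hfz, hgz, hzc] at h
    rcases hr0.eq_or_lt with h0 | h0
    · rw [← h0] at h hneg
      linarith
    · exact h0
  have hci : Integrable c (μ.prod ν) :=
    Integrable.of_bound hc.aestronglyMeasurable M (Filter.Eventually.of_forall hM)
  -- Each restriction of `μ ⊗ ν` to a measurable set has marginals dominated by `μ` and `ν`, so it
  -- lies in the range of the test measures. Nonnegativity of all these integrals gives the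
  -- inequality almost everywhere.
  have hae : 0 ≤ᵐ[μ.prod ν] fun p : X × Y => f p.1 + g p.2 + r * c p := by
    refine ae_nonneg_of_forall_setIntegral_nonneg
      (((hzf f).1.add (hzg g).1).add (hci.const_mul r)) fun E hE _ => ?_
    obtain ⟨z', hz', hzc', hzf', hzg'⟩ := exists_mem_costCone (μ := μ) (ν := ν) c
      (Q := (μ.prod ν).restrict E)
      ((Measure.fst_mono Measure.restrict_le_self).trans hfst.le)
      ((Measure.snd_mono Measure.restrict_le_self).trans hsnd.le)
    have h := hpos z' hz'
    rw [hℓ, ← (hzf' f).2, ← (hzg' g).2, hzc'] at h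
    rwa [← integral_const_mul, ← integral_add (hzf' f).1 (hzg' g).1,
      ← integral_add (by exact (hzf' f).1.add (hzg' g).1) (hci.restrict.const_mul r)] at h
  refine ⟨fun x => -(f x / r), ⟨((Lp.stronglyMeasurable f).measurable.div_const r).neg,
    ((integrable_coe_Lp_two f).div_const r).neg⟩, fun y => -(g y / r),
    ⟨((Lp.stronglyMeasurable g).measurable.div_const r).neg,
    ((integrable_coe_Lp_two g).div_const r).neg⟩, ?_, ?_⟩
  · filter_upwards [hae] with p hp
    have hp' : 0 ≤ f p.1 + g p.2 + r * c p := hp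
    have : -(f p.1 / r) + -(g p.2 / r) = -(f p.1 + g p.2) / r := by ring
    rw [this, div_le_iff₀ hrpos]
    linarith
  · rw [integral_neg, integral_neg, integral_div, integral_div]
    have : -((∫ x, f x ∂μ) / r) + -((∫ y, g y ∂ν) / r) = -(∫ x, f x ∂μ + ∫ y, g y ∂ν) / r := by
      ring
    rw [this, le_div_iff₀ hrpos]
    linarith

end Cone

end MassTransport

namespace MassTransport

/-! ### Integration against couplings and weak duality -/

section Couplings

variable {X Y : Type*} [MeasurableSpace X] [MeasurableSpace Y]

theorem integrable_fst_of_mem_couplings {μ : Measure X} {ν : Measure Y} [IsProbabilityMeasure μ]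
    {P : Measure (X × Y)} (hP : P ∈ couplings μ ν) {f : X → ℝ} (hf : f ∈ L1 μ) :
    Integrable (fun p : X × Y => f p.1) P ∧ ∫ p : X × Y, f p.1 ∂P = ∫ x, f x ∂μ := by
  have h := (mem_couplings_iff.1 hP).1
  subst h
  exact ⟨hf.2.comp_measurable measurable_fst,
    (integral_map measurable_fst.aemeasurable hf.1.aestronglyMeasurable).symm⟩

theorem integrable_snd_of_mem_couplings {μ : Measure X} {ν : Measure Y} [IsProbabilityMeasure μ]
    {P : Measure (X × Y)} (hP : P ∈ couplings μ ν) {g : Y → ℝ} (hg : g ∈ L1 ν) :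
    Integrable (fun p : X × Y => g p.2) P ∧ ∫ p : X × Y, g p.2 ∂P = ∫ y, g y ∂ν := by
  have h := (mem_couplings_iff.1 hP).2
  subst h
  exact ⟨hg.2.comp_measurable measurable_snd,
    (integral_map measurable_snd.aemeasurable hg.1.aestronglyMeasurable).symm⟩

theorem ae_fst_mem_of_mem_couplings {μ : Measure X} {ν : Measure Y} {P : Measure (X × Y)}
    (hP : P ∈ couplings μ ν) {A : Set X} (hA : MeasurableSet A) (hA1 : μ A = 1) :
    ∀ᵐ p ∂P, p.1 ∈ A := by
  have := hP.1
  refine (prob_compl_eq_zero_iff (measurable_fst hA)).2 ?_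
  rw [← hA1, ← hP.2.1 A hA, Set.prod_univ]

theorem prod_mem_couplings (μ : Measure X) (ν : Measure Y) [IsProbabilityMeasure μ]
    [IsProbabilityMeasure ν] : μ.prod ν ∈ couplings μ ν :=
  mem_couplings_iff.2 ⟨Measure.fst_prod, Measure.snd_prod⟩

theorem integral_add_integral_le_of_mem_couplings {μ : Measure X} {ν : Measure Y}
    [IsProbabilityMeasure μ] {P : Measure (X × Y)} (hP : P ∈ couplings μ ν) {c : X × Y → ℝ}
    (hc : Integrable c P) {f : X → ℝ} (hf : f ∈ L1 μ) {g : Y → ℝ} (hg : g ∈ L1 ν)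
    (h : ∀ x y, f x + g y ≤ c (x, y)) :
    ∫ x, f x ∂μ + ∫ y, g y ∂ν ≤ ∫ p, c p ∂P := by
  have h1 := integrable_fst_of_mem_couplings hP hf
  have h2 := integrable_snd_of_mem_couplings hP hg
  rw [← h1.2, ← h2.2, ← integral_add h1.1 h2.1]
  exact integral_mono (h1.1.add h2.1) hc fun p => h p.1 p.2

theorem IntegrableBounds.neg {μ : Measure X} {ν : Measure Y} {c : X × Y → ℝ}
    (hc : IntegrableBounds μ ν c) : IntegrableBounds μ ν fun p => -c p := by
  obtain ⟨f₁, hf₁, g₁, hg₁, f₂, hf₂, g₂, hg₂, h⟩ := hc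
  refine ⟨fun x => -f₂ x, ⟨hf₂.1.neg, hf₂.2.neg⟩, fun y => -g₂ y, ⟨hg₂.1.neg, hg₂.2.neg⟩,
    fun x => -f₁ x, ⟨hf₁.1.neg, hf₁.2.neg⟩, fun y => -g₁ y, ⟨hg₁.1.neg, hg₁.2.neg⟩, fun x y => ?_⟩
  have := h x y
  constructor <;> linarith

theorem IntegrableBounds.swap {μ : Measure X} {ν : Measure Y} {c : X × Y → ℝ}
    (hc : IntegrableBounds μ ν c) : IntegrableBounds ν μ fun p => c p.swap := by
  obtain ⟨f₁, hf₁, g₁, hg₁, f₂, hf₂, g₂, hg₂, h⟩ := hc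
  refine ⟨g₁, hg₁, f₁, hf₁, g₂, hg₂, f₂, hf₂, fun y x => ?_⟩
  have := h x y
  constructor <;> simp only [Prod.swap_prod_mk] <;> linarith

theorem IntegrableBounds.integrable {μ : Measure X} {ν : Measure Y} [IsProbabilityMeasure μ]
    {c : X × Y → ℝ} (hc : IntegrableBounds μ ν c) {P : Measure (X × Y)} (hP : P ∈ couplings μ ν)
    (hm : AEStronglyMeasurable c P) : Integrable c P := by
  obtain ⟨f₁, hf₁, g₁, hg₁, f₂, hf₂, g₂, hg₂, h⟩ := hc
  have h1 := (integrable_fst_of_mem_couplings hP hf₁).1.add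
    (integrable_snd_of_mem_couplings hP hg₁).1
  have h2 := (integrable_fst_of_mem_couplings hP hf₂).1.add
    (integrable_snd_of_mem_couplings hP hg₂).1
  exact integrable_of_le_of_le hm (Filter.Eventually.of_forall fun p => (h p.1 p.2).1)
    (Filter.Eventually.of_forall fun p => (h p.1 p.2).2) h1 h2

theorem map_swap_mem_couplings {μ : Measure X} {ν : Measure Y} [IsProbabilityMeasure μ]
    [IsProbabilityMeasure ν] {P : Measure (X × Y)} (hP : P ∈ couplings μ ν) :
    P.map Prod.swap ∈ couplings ν μ := by
  rw [mem_couplings_iff] at hP ⊢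
  rw [Measure.fst_map_swap, Measure.snd_map_swap]
  exact hP.symm

theorem integral_map_prod_swap (c : X × Y → ℝ) (P : Measure (X × Y)) :
    ∫ q, c q.swap ∂(P.map Prod.swap) = ∫ p, c p ∂P := by
  rw [show (Prod.swap : X × Y → Y × X) = MeasurableEquiv.prodComm from rfl, integral_map_equiv]
  rfl

end Couplings

/-! ### One null set for all `x` -/

section NullSets

variable {X Y : Type*} [MetricSpace X] [MeasurableSpace Y]

/-- If `f(x) + g(y) ≤ c(x, y)` for almost all `y`, for every `x` in a separable set, then one null
set of `y` serves for all `x` simultaneously. -/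
theorem ae_forall_add_le_of_forall_ae {ν : Measure Y} {A : Set X}
    (hs : TopologicalSpace.IsSeparable A) {c : X × Y → ℝ} (hcx : ∀ y, Continuous fun x => c (x, y))
    {f : X → ℝ} {g : Y → ℝ} (h : ∀ x ∈ A, ∀ᵐ y ∂ν, f x + g y ≤ c (x, y)) :
    ∀ᵐ y ∂ν, ∀ x ∈ A, f x + g y ≤ c (x, y) := by
  -- As `f` need not be continuous, a countable dense subset of `A` would not do. A dense subset of
  -- the graph approximates `x` and `f x` together, and for fixed `y` the constraint is closed in `X
  -- × ℝ`.
  have hsep : TopologicalSpace.IsSeparable ((fun x => (x, f x)) '' A) := by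
    refine (hs.prod (TopologicalSpace.IsSeparable.of_separableSpace (Set.univ : Set ℝ))).mono ?_
    rintro _ ⟨x, hx, rfl⟩
    exact ⟨hx, Set.mem_univ _⟩
  obtain ⟨D, hD, hDc, hDd⟩ := hsep.exists_countable_dense_subset
  have hae : ∀ᵐ y ∂ν, ∀ d ∈ D, d.2 + g y ≤ c (d.1, y) := by
    refine (ae_ball_iff hDc).2 fun d hd => ?_
    obtain ⟨x, hx, rfl⟩ := hD hd
    exact h x hx
  filter_upwards [hae] with y hy x hx
  have hcl : IsClosed {d : X × ℝ | d.2 + g y ≤ c (d.1, y)} :=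
    isClosed_le (by fun_prop) ((hcx y).comp continuous_fst)
  exact closure_minimal hy hcl (hDd ⟨x, hx, rfl⟩)

end NullSets

/-! ### Strong duality for Carathéodory costs -/

section Caratheodory

variable {X Y : Type*} [MetricSpace X] [MeasurableSpace X] [BorelSpace X] [MeasurableSpace Y]

/-- A Carathéodory function agrees on `A × Y`, for `A` separable, with a jointly measurable
function. -/
theorem exists_measurable_eq_of_isSeparable {A : Set X} (hA : MeasurableSet A)
    (hs : TopologicalSpace.IsSeparable A) {c : X × Y → ℝ} (hcx : ∀ y, Continuous fun x => c (x, y))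
    (hcy : ∀ x, Measurable fun y => c (x, y)) :
    ∃ c₀ : X × Y → ℝ, Measurable c₀ ∧ (∀ x ∈ A, ∀ y, c₀ (x, y) = c (x, y)) ∧
      ∀ x ∉ A, ∀ y, c₀ (x, y) = 0 := by
  have : TopologicalSpace.SeparableSpace A := hs.separableSpace
  have : SecondCountableTopology A := UniformSpace.secondCountable_of_separable A
  -- Joint measurability of Carathéodory functions applies over the second countable subspace `A`.
  -- The extension by zero is then measurable because `A × Y` embeds measurably in `X × Y`.
  have hm : StronglyMeasurable (Function.uncurry fun (x : A) (y : Y) => c (x, y)) :=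
    stronglyMeasurable_uncurry_of_continuous_of_stronglyMeasurable
      (fun y => (hcx y).comp continuous_subtype_val) fun x => (hcy x).stronglyMeasurable
  have he : MeasurableEmbedding (Prod.map (Subtype.val : A → X) (id : Y → Y)) :=
    (MeasurableEmbedding.subtype_coe hA).prodMap MeasurableEmbedding.id
  refine ⟨Function.extend (Prod.map Subtype.val id) _ fun _ => 0,
    he.measurable_extend hm.measurable measurable_const, fun x hx y => ?_, fun x hx y => ?_⟩
  · exact he.injective.extend_apply (Function.uncurry fun (x : A) (y : Y) => c (x, y)) (fun _ => 0)
      (⟨x, hx⟩, y)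
  · refine Function.extend_apply' _ _ _ ?_
    rintro ⟨⟨x', y'⟩, h⟩
    exact hx ((show (x' : X) = x from congrArg Prod.fst h) ▸ x'.2)

/-- Every coupling is carried by `A × Y`, where `c` agrees with a jointly measurable function. Thus
`c` is measurable for the completion even when it is not product measurable, and the bounds do the
rest. -/
theorem IntegrableBounds.integrable_of_separable {μ : Measure X} {ν : Measure Y}
    [IsProbabilityMeasure μ] {c : X × Y → ℝ} (hc : IntegrableBounds μ ν c)
    (hcx : ∀ y, Continuous fun x => c (x, y)) (hcy : ∀ x, Measurable fun y => c (x, y))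
    (hμ : SeparableMeasure μ) {P : Measure (X × Y)} (hP : P ∈ couplings μ ν) :
    Integrable c P := by
  obtain ⟨A, hA, hs, hA1⟩ := hμ
  obtain ⟨c₀, hm, he, -⟩ := exists_measurable_eq_of_isSeparable hA hs hcx hcy
  refine hc.integrable hP (hm.aestronglyMeasurable.congr ?_)
  filter_upwards [ae_fst_mem_of_mem_couplings hP hA hA1] with p hp
  exact he p.1 hp p.2

/-- Duality for a bounded Carathéodory cost. -/
theorem exists_dual_of_bounded {μ : Measure X} {ν : Measure Y} [IsProbabilityMeasure μ]
    [IsProbabilityMeasure ν] (hμ : SeparableMeasure μ) {c : X × Y → ℝ}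
    (hcx : ∀ y, Continuous fun x => c (x, y)) (hcy : ∀ x, Measurable fun y => c (x, y)) {M : ℝ}
    (hM : ∀ p, |c p| ≤ M) {a : ℝ} (ha : ∀ P ∈ couplings μ ν, a ≤ ∫ p, c p ∂P) {ε : ℝ}
    (hε : 0 < ε) :
    ∃ f ∈ L1 μ, ∃ g ∈ L1 ν, (∀ x y, f x + g y ≤ c (x, y)) ∧
      a - ε ≤ ∫ x, f x ∂μ + ∫ y, g y ∂ν := by
  classical
  obtain ⟨A, hA, hs, hA1⟩ := hμ
  obtain ⟨c₀, hm, he, he0⟩ := exists_measurable_eq_of_isSeparable hA hs hcx hcy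
  have hM0 : 0 ≤ M := by
    obtain ⟨p⟩ := nonempty_of_isProbabilityMeasure (μ.prod ν)
    exact (abs_nonneg _).trans (hM p)
  have hM' : ∀ p, |c₀ p| ≤ M := by
    rintro ⟨x, y⟩
    by_cases hx : x ∈ A
    · rw [he x hx]
      exact hM _
    · rwa [he0 x hx, abs_zero]
  have ha' : ∀ P ∈ couplings μ ν, a ≤ ∫ p, c₀ p ∂P := by
    intro P hP
    refine (ha P hP).trans_eq (integral_congr_ae ?_)
    filter_upwards [ae_fst_mem_of_mem_couplings hP hA hA1] with p hp
    exact (he p.1 hp p.2).symm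
  obtain ⟨f, hf, g, hg, hfg, hval⟩ := exists_dual_ae hm hM' ha' hε
  have hae : ∀ᵐ x ∂μ, x ∈ A ∧ ∀ᵐ y ∂ν, f x + g y ≤ c (x, y) := by
    have hxA : ∀ᵐ x ∂μ, x ∈ A := (prob_compl_eq_zero_iff hA).2 hA1
    filter_upwards [hxA, Measure.ae_ae_of_ae_prod hfg] with x hx h
    refine ⟨hx, ?_⟩
    filter_upwards [h] with y hy
    rwa [← he x hx]
  obtain ⟨A', hA'ae, hA'm, hA'⟩ := hae.exists_measurable_mem
  obtain ⟨B, hBae, hBm, hB⟩ := (ae_forall_add_le_of_forall_ae (hs.mono fun x hx => (hA' x hx).1)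
    hcx fun x hx => (hA' x hx).2).exists_measurable_mem
  obtain ⟨x₀, hx₀⟩ := (Filter.nonempty_of_mem hA'ae)
  obtain ⟨y₀, hy₀⟩ := (Filter.nonempty_of_mem hBae)
  -- For `x ∈ A'`, the constraint at `y₀` gives `f x ≤ M + |g y₀|`, so `f x - K ≤ -M ≤ c`. The case
  -- `y ∈ B` is symmetric through `x₀`, and off both sets `-2K ≤ -M`.
  set K : ℝ := 2 * M + |f x₀| + |g y₀| with hK
  have hf' : f =ᵐ[μ] A'.piecewise f fun _ => -K := by
    filter_upwards [hA'ae] with x hx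
    rw [Set.piecewise_eq_of_mem _ _ _ hx]
  have hg' : g =ᵐ[ν] B.piecewise g fun _ => -K := by
    filter_upwards [hBae] with y hy
    rw [Set.piecewise_eq_of_mem _ _ _ hy]
  refine ⟨A'.piecewise f fun _ => -K, ⟨hf.1.piecewise hA'm measurable_const, hf.2.congr hf'⟩,
    B.piecewise g fun _ => -K, ⟨hg.1.piecewise hBm measurable_const, hg.2.congr hg'⟩, ?_, ?_⟩
  · intro x y
    have hcM := fun x y => abs_le.1 (hM (x, y))
    have h1 := neg_abs_le (f x₀)
    have h2 := neg_abs_le (g y₀)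
    have h3 := abs_nonneg (f x₀)
    have h4 := abs_nonneg (g y₀)
    by_cases hx : x ∈ A' <;> by_cases hy : y ∈ B <;> simp only [Set.piecewise, hx, hy, if_true,
      if_false]
    · exact hB y hy x hx
    · linarith [hB y₀ hy₀ x hx, (hcM x y₀).2, (hcM x y).1]
    · linarith [hB y hy x₀ hx₀, (hcM x₀ y).2, (hcM x y).1]
    · linarith [(hcM x y).1]
  · rwa [← integral_congr_ae hf', ← integral_congr_ae hg']

theorem tendsto_integral_max_sub_natCast {Z : Type*} [MeasurableSpace Z] {Q : Measure Z}
    {f : Z → ℝ} (hf : Integrable f Q) :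
    Filter.Tendsto (fun k : ℕ => ∫ z, max (f z - k) 0 ∂Q) Filter.atTop (nhds 0) := by
  have := tendsto_integral_of_dominated_convergence (μ := Q)
    (F := fun (k : ℕ) z => max (f z - k) 0) (f := fun _ => 0) (fun z => |f z|) ?_ hf.abs ?_ ?_
  · simpa using this
  · intro k
    exact (hf.1.sub aestronglyMeasurable_const).sup aestronglyMeasurable_const
  · intro k
    refine Filter.Eventually.of_forall fun z => ?_
    rw [Real.norm_eq_abs, abs_of_nonneg (le_max_right _ _)]
    have : (0 : ℝ) ≤ k := k.cast_nonneg
    exact max_le (by linarith [le_abs_self (f z)]) (abs_nonneg _)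
  · refine Filter.Eventually.of_forall fun z => ?_
    refine tendsto_const_nhds.congr' ?_
    obtain ⟨n, hn⟩ := exists_nat_ge (f z)
    filter_upwards [Filter.eventually_ge_atTop n] with k hk
    have : (n : ℝ) ≤ k := by exact_mod_cast hk
    rw [max_eq_right (by linarith)]

theorem max_sub_const_mem_L1 {Z : Type*} [MeasurableSpace Z] {Q : Measure Z}
    [IsFiniteMeasure Q] {f : Z → ℝ} (hf : f ∈ L1 Q) (k : ℝ) : (fun z => max (f z - k) 0) ∈ L1 Q :=
  ⟨(hf.1.sub_const k).max measurable_const, (hf.2.sub (integrable_const k)).sup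
    (integrable_const 0)⟩

/-- Duality for a Carathéodory cost with integrable bounds. -/
theorem exists_dual {μ : Measure X} {ν : Measure Y} [IsProbabilityMeasure μ]
    [IsProbabilityMeasure ν] (hμ : SeparableMeasure μ) {c : X × Y → ℝ}
    (hc : IntegrableBounds μ ν c)
    (hcx : ∀ y, Continuous fun x => c (x, y)) (hcy : ∀ x, Measurable fun y => c (x, y))
    {a : ℝ} (ha : ∀ P ∈ couplings μ ν, a ≤ ∫ p, c p ∂P) {ε : ℝ} (hε : 0 < ε) :
    ∃ f ∈ L1 μ, ∃ g ∈ L1 ν, (∀ x y, f x + g y ≤ c (x, y)) ∧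
      a - ε ≤ ∫ x, f x ∂μ + ∫ y, g y ∂ν := by
  have hint := fun P (hP : P ∈ couplings μ ν) => hc.integrable_of_separable hcx hcy hμ hP
  obtain ⟨f₁, hf₁, g₁, hg₁, f₂, hf₂, g₂, hg₂, hb⟩ := hc
  -- Four tails below `ε / 16` make `∫ h + ∫ j < ε / 4`. This is paid twice, when `c` is replaced by
  -- its truncation and when `h`, `j` are subtracted from the dual pair; `ε / 2` is left for bounded
  -- duality.
  have hlt : (0 : ℝ) < ε / 16 := by linarith
  have hf₁' : (fun x => -f₁ x) ∈ L1 μ := ⟨hf₁.1.neg, hf₁.2.neg⟩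
  have hg₁' : (fun y => -g₁ y) ∈ L1 ν := ⟨hg₁.1.neg, hg₁.2.neg⟩
  obtain ⟨k, k1, k2, k3, k4⟩ :=
    (((tendsto_integral_max_sub_natCast hf₁'.2).eventually_lt_const hlt).and
      (((tendsto_integral_max_sub_natCast hg₁'.2).eventually_lt_const hlt).and
        (((tendsto_integral_max_sub_natCast hf₂.2).eventually_lt_const hlt).and
          ((tendsto_integral_max_sub_natCast hg₂.2).eventually_lt_const hlt)))).exists
  have m1 := max_sub_const_mem_L1 hf₁' k
  have m2 := max_sub_const_mem_L1 hg₁' k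
  have m3 := max_sub_const_mem_L1 hf₂ k
  have m4 := max_sub_const_mem_L1 hg₂ k
  set h : X → ℝ := fun x => max (-f₁ x - k) 0 + max (f₂ x - k) 0 with hh
  set j : Y → ℝ := fun y => max (-g₁ y - k) 0 + max (g₂ y - k) 0 with hj
  have hhL : h ∈ L1 μ := ⟨m1.1.add m3.1, m1.2.add m3.2⟩
  have hjL : j ∈ L1 ν := ⟨m2.1.add m4.1, m2.2.add m4.2⟩
  have hhI : ∫ x, h x ∂μ < ε / 8 := by
    rw [hh, integral_add m1.2 m3.2]
    linarith
  have hjI : ∫ y, j y ∂ν < ε / 8 := by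
    rw [hj, integral_add m2.2 m4.2]
    linarith
  have hk : (0 : ℝ) ≤ k := k.cast_nonneg
  set c' : X × Y → ℝ := fun p => max (-(2 * k)) (min (c p) (2 * k)) with hc'
  -- The level `2k` is `k` for each variable: the excess of `f₂ + g₂` over `2k` is at most `(f₂ -
  -- k)⁺ + (g₂ - k)⁺`, and likewise for `-f₁ - g₁`.
  have hclose : ∀ x y, c (x, y) ≤ c' (x, y) + h x + j y ∧ c' (x, y) ≤ c (x, y) + h x + j y := by
    intro x y
    have b := hb x y
    have u1 := le_max_left (-f₁ x - k) 0
    have u2 := le_max_left (-g₁ y - k) 0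
    have u3 := le_max_left (f₂ x - k) 0
    have u4 := le_max_left (g₂ y - k) 0
    have v1 := le_max_right (-f₁ x - k) 0
    have v2 := le_max_right (-g₁ y - k) 0
    have v3 := le_max_right (f₂ x - k) 0
    have v4 := le_max_right (g₂ y - k) 0
    simp only [hc', hh, hj]
    constructor
    · rcases le_total (c (x, y)) (2 * k) with h1 | h1
      · rw [min_eq_left h1]
        linarith [le_max_right (-(2 * (k : ℝ))) (c (x, y))]
      · rw [min_eq_right h1]
        linarith [le_max_right (-(2 * (k : ℝ))) (2 * k)]
    · rw [max_le_iff]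
      constructor
      · linarith
      · linarith [min_le_left (c (x, y)) (2 * k)]
  have hM : ∀ p, |c' p| ≤ 2 * k := fun p => abs_le.2 ⟨le_max_left _ _,
    max_le (by linarith) (min_le_right _ _)⟩
  have hcx' : ∀ y, Continuous fun x => c' (x, y) := fun y =>
    continuous_const.max ((hcx y).min continuous_const)
  have hcy' : ∀ x, Measurable fun y => c' (x, y) := fun x =>
    measurable_const.max ((hcy x).min measurable_const)
  have ha' : ∀ P ∈ couplings μ ν, a - ε / 4 ≤ ∫ p, c' p ∂P := by
    intro P hP
    have i1 := integrable_fst_of_mem_couplings hP hhL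
    have i2 := integrable_snd_of_mem_couplings hP hjL
    have := hP.1
    have i3 : Integrable c' P := (integrable_const _).sup ((hint P hP).inf (integrable_const _))
    have : ∫ p, c p ∂P ≤ ∫ p : X × Y, (c' p + h p.1 + j p.2) ∂P :=
      integral_mono (hint P hP) ((i3.add i1.1).add i2.1) fun p => (hclose p.1 p.2).1
    rw [integral_add (by exact i3.add i1.1) i2.1, integral_add i3 i1.1, i1.2, i2.2] at this
    linarith [ha P hP]
  obtain ⟨f, hf, g, hg, hfg, hval⟩ := exists_dual_of_bounded hμ hcx' hcy' hM ha'
    (by linarith : 0 < ε / 2)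
  refine ⟨fun x => f x - h x, ⟨hf.1.sub hhL.1, hf.2.sub hhL.2⟩, fun y => g y - j y,
    ⟨hg.1.sub hjL.1, hg.2.sub hjL.2⟩, fun x y => ?_, ?_⟩
  · linarith [hfg x y, (hclose x y).2]
  · rw [integral_sub hf.2 hhL.2, integral_sub hg.2 hjL.2]
    linarith

theorem alpha_eq_beta {μ : Measure X} {ν : Measure Y} [IsProbabilityMeasure μ]
    [IsProbabilityMeasure ν] (hμ : SeparableMeasure μ) {c : X × Y → ℝ}
    (hc : IntegrableBounds μ ν c)
    (hcx : ∀ y, Continuous fun x => c (x, y)) (hcy : ∀ x, Measurable fun y => c (x, y)) :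
    alpha μ ν c = beta μ ν c := by
  have hint := fun P (hP : P ∈ couplings μ ν) => hc.integrable_of_separable hcx hcy hμ hP
  have hweak : ∀ r ∈ {r | ∃ P ∈ couplings μ ν, r = ∫ p, c p ∂P},
      ∀ s ∈ {r | ∃ f ∈ L1 μ, ∃ g ∈ L1 ν, (∀ x y, f x + g y ≤ c (x, y)) ∧
        r = ∫ x, f x ∂μ + ∫ y, g y ∂ν}, s ≤ r := by
    rintro r ⟨P, hP, rfl⟩ s ⟨f, hf, g, hg, hfg, rfl⟩
    exact integral_add_integral_le_of_mem_couplings hP (hint P hP) hf hg hfg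
  have hne1 : {r | ∃ P ∈ couplings μ ν, r = ∫ p, c p ∂P}.Nonempty :=
    ⟨_, _, prod_mem_couplings μ ν, rfl⟩
  have hne2 : {r | ∃ f ∈ L1 μ, ∃ g ∈ L1 ν, (∀ x y, f x + g y ≤ c (x, y)) ∧
      r = ∫ x, f x ∂μ + ∫ y, g y ∂ν}.Nonempty := by
    obtain ⟨f₁, hf₁, g₁, hg₁, f₂, -, g₂, -, hb⟩ := hc
    exact ⟨_, f₁, hf₁, g₁, hg₁, fun x y => (hb x y).1, rfl⟩
  refine le_antisymm (le_of_forall_sub_le fun ε hε => ?_)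
    (csSup_le hne2 fun s hs => le_csInf hne1 fun r hr => hweak r hr s hs)
  -- The real infimum is a genuine lower bound only for a set bounded below. Any admissible dual
  -- pair supplies that bound by weak duality.
  obtain ⟨f, hf, g, hg, hfg, hval⟩ := exists_dual hμ hc hcx hcy (a := alpha μ ν c)
    (fun P hP => csInf_le ⟨_, fun r hr => hweak r hr _ hne2.some_mem⟩ ⟨P, hP, rfl⟩) hε
  exact hval.trans (le_csSup ⟨_, fun s hs => hweak _ hne1.some_mem s hs⟩ ⟨f, hf, g, hg, hfg, rfl⟩)

end Caratheodory

/-! ### Change of sign and exchange of factors -/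

section Symmetries

variable {X Y : Type*} [MeasurableSpace X] [MeasurableSpace Y]

theorem alphaStar_eq_neg_alpha_neg (μ : Measure X) (ν : Measure Y) (c : X × Y → ℝ) :
    alphaStar μ ν c = -alpha μ ν fun p => -c p := by
  rw [alpha, alphaStar, ← Real.sSup_neg]
  congr 1
  ext r
  simp only [Set.mem_neg, Set.mem_ofPred_eq, integral_neg, neg_inj]

theorem betaStar_eq_neg_beta_neg (μ : Measure X) (ν : Measure Y) (c : X × Y → ℝ) :
    betaStar μ ν c = -beta μ ν fun p => -c p := by
  rw [beta, betaStar, ← Real.sInf_neg]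
  congr 1
  ext r
  simp only [Set.mem_neg, Set.mem_ofPred_eq]
  constructor
  all_goals
    rintro ⟨f, hf, g, hg, h, hr⟩
    refine ⟨fun x => -f x, ⟨hf.1.neg, hf.2.neg⟩, fun y => -g y, ⟨hg.1.neg, hg.2.neg⟩,
      fun x y => ?_, ?_⟩
    · linarith [h x y]
    · rw [integral_neg, integral_neg]
      linarith

theorem alpha_swap (μ : Measure X) (ν : Measure Y) [IsProbabilityMeasure μ]
    [IsProbabilityMeasure ν] (c : X × Y → ℝ) :
    alpha ν μ (fun p => c p.swap) = alpha μ ν c := by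
  rw [alpha, alpha]
  congr 1
  ext r
  constructor
  · rintro ⟨P, hP, rfl⟩
    exact ⟨_, map_swap_mem_couplings hP, (integral_map_prod_swap (fun q => c q.swap) P).symm⟩
  · rintro ⟨P, hP, rfl⟩
    exact ⟨_, map_swap_mem_couplings hP, (integral_map_prod_swap c P).symm⟩

theorem beta_swap (μ : Measure X) (ν : Measure Y) (c : X × Y → ℝ) :
    beta ν μ (fun p => c p.swap) = beta μ ν c := by
  rw [beta, beta]
  congr 1
  ext r
  constructor
  all_goals
    rintro ⟨f, hf, g, hg, h, rfl⟩
    refine ⟨g, hg, f, hf, fun x y => ?_, add_comm _ _⟩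
    rw [add_comm]
    exact h y x

end Symmetries

/-! ### Upper duality and separately continuous costs -/

section Duality

variable {X Y : Type*} [MetricSpace X] [MeasurableSpace X] [BorelSpace X]

theorem alphaStar_eq_betaStar [MeasurableSpace Y] {μ : Measure X} {ν : Measure Y}
    [IsProbabilityMeasure μ] [IsProbabilityMeasure ν] (hμ : SeparableMeasure μ) {c : X × Y → ℝ}
    (hc : IntegrableBounds μ ν c)
    (hcx : ∀ y, Continuous fun x => c (x, y)) (hcy : ∀ x, Measurable fun y => c (x, y)) :
    alphaStar μ ν c = betaStar μ ν c := by
  rw [alphaStar_eq_neg_alpha_neg, betaStar_eq_neg_beta_neg,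
    alpha_eq_beta hμ hc.neg (fun y => (hcx y).neg) fun x => (hcy x).neg]

variable [MetricSpace Y] [MeasurableSpace Y] [BorelSpace Y]

theorem alpha_eq_beta_of_continuous {μ : Measure X} {ν : Measure Y} [IsProbabilityMeasure μ]
    [IsProbabilityMeasure ν] (h : SeparableMeasure μ ∨ SeparableMeasure ν) {c : X × Y → ℝ}
    (hc : IntegrableBounds μ ν c) (hcx : ∀ y, Continuous fun x => c (x, y))
    (hcy : ∀ x, Continuous fun y => c (x, y)) : alpha μ ν c = beta μ ν c := by
  rcases h with h | h
  · exact alpha_eq_beta h hc hcx fun x => (hcy x).measurable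
  · rw [← alpha_swap, ← beta_swap]
    exact alpha_eq_beta h hc.swap hcy fun y => (hcx y).measurable

theorem alphaStar_eq_betaStar_of_continuous {μ : Measure X} {ν : Measure Y}
    [IsProbabilityMeasure μ] [IsProbabilityMeasure ν]
    (h : SeparableMeasure μ ∨ SeparableMeasure ν) {c : X × Y → ℝ}
    (hc : IntegrableBounds μ ν c) (hcx : ∀ y, Continuous fun x => c (x, y))
    (hcy : ∀ x, Continuous fun y => c (x, y)) : alphaStar μ ν c = betaStar μ ν c := by
  rw [alphaStar_eq_neg_alpha_neg, betaStar_eq_neg_beta_neg,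
    alpha_eq_beta_of_continuous h hc.neg (fun y => (hcx y).neg) fun x => (hcy x).neg]

/-- With both families of sections continuous, the roles of the factors can be exchanged.
Integrability is obtained for the swapped cost and coupling and pulled back along the swap. -/
theorem IntegrableBounds.integrable_of_continuous {μ : Measure X} {ν : Measure Y}
    [IsProbabilityMeasure μ] [IsProbabilityMeasure ν] {c : X × Y → ℝ}
    (hc : IntegrableBounds μ ν c) (hcx : ∀ y, Continuous fun x => c (x, y))
    (hcy : ∀ x, Continuous fun y => c (x, y)) (hν : SeparableMeasure ν) {P : Measure (X × Y)}
    (hP : P ∈ couplings μ ν) : Integrable c P := by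
  have h := hc.swap.integrable_of_separable hcy (fun y => (hcx y).measurable) hν
    (map_swap_mem_couplings hP)
  simpa [Function.comp_def] using h.comp_measurable measurable_swap

end Duality

end MassTransport

theorem theorem3p3 {X Y : Type*}
    [MetricSpace X] [MeasurableSpace X] [BorelSpace X]
    [MetricSpace Y] [MeasurableSpace Y] [BorelSpace Y]
    (μ : Measure X) [IsProbabilityMeasure μ] (ν : Measure Y) [IsProbabilityMeasure ν]
    (c : X × Y → ℝ) (hc : MassTransport.IntegrableBounds μ ν c)
    (hcx : ∀ y, Continuous fun x => c (x, y))
    (hcy : ∀ x, Measurable fun y => c (x, y)) :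
    -- the integrals in `alpha` and `alphaStar` make sense in all the cases below
    ((MassTransport.SeparableMeasure μ ∨
        ((∀ x, Continuous fun y => c (x, y)) ∧ MassTransport.SeparableMeasure ν)) →
      ∀ P ∈ MassTransport.couplings μ ν, Integrable c P) ∧
    -- (i)
    (BddBelow (Set.range c) → MassTransport.SeparableMeasure μ →
      MassTransport.alphaStar μ ν c = MassTransport.betaStar μ ν c) ∧
    -- (ii)
    (BddAbove (Set.range c) → MassTransport.SeparableMeasure μ →
      MassTransport.alpha μ ν c = MassTransport.beta μ ν c) ∧
    -- (iii)
    (BddBelow (Set.range c) → BddAbove (Set.range c) → MassTransport.SeparableMeasure μ →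
      MassTransport.alpha μ ν c = MassTransport.beta μ ν c ∧
      MassTransport.alphaStar μ ν c = MassTransport.betaStar μ ν c) ∧
    -- (iv)
    ((∀ x, Continuous fun y => c (x, y)) →
      (MassTransport.SeparableMeasure μ ∨ MassTransport.SeparableMeasure ν) →
      MassTransport.alpha μ ν c = MassTransport.beta μ ν c ∧
      MassTransport.alphaStar μ ν c = MassTransport.betaStar μ ν c) := by
  refine ⟨?_, fun _ hμ => MassTransport.alphaStar_eq_betaStar hμ hc hcx hcy,
    fun _ hμ => MassTransport.alpha_eq_beta hμ hc hcx hcy,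
    fun _ _ hμ => ⟨MassTransport.alpha_eq_beta hμ hc hcx hcy,
      MassTransport.alphaStar_eq_betaStar hμ hc hcx hcy⟩,
    fun hcy' h => ⟨MassTransport.alpha_eq_beta_of_continuous h hc hcx hcy',
      MassTransport.alphaStar_eq_betaStar_of_continuous h hc hcx hcy'⟩⟩
  rintro (hμ | ⟨hcy', hν⟩) P hP
  · exact hc.integrable_of_separable hcx hcy hμ hP
  · exact hc.integrable_of_continuous hcx hcy' hν hP
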